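/- Let $\mathcal{E}$ be a locally presentable category and write $1$ for its terminal object. For a class $K$ of maps of $\mathcal{E}$ let $\mathrm{inj}(K)$ be the class of maps with the right lifting property with respect to every map in $K$, let $\mathrm{cof}(K)$ be the class of maps with the left lifting property with respect to every map in $\mathrm{inj}(K)$, and let $\mathrm{cell}(K)$ be the class of relative $K$-cell complexes, that is, of transfinite compositions of pushouts of coproducts of maps in $K$. Let $\mathrm{W}$ be a full accessible subcategory of the category of maps $\mathrm{Mor}(\mathcal{E})$ (that is, the full subcategory on the maps in $\mathrm{W}$ is an accessible category, and its inclusion into $\mathrm{Mor}(\mathcal{E})$ preserves $\kappa$-filtered colimits for some regular cardinal $\kappa$), and let $I$ and $J$ be two (small) sets of maps of $\mathcal{E}$. Call a map of $\mathcal{E}$ a naive fibration if it belongs to $\mathrm{inj}(J)$, and call an object $X$ naively fibrant if $X\to 1$ is a naive fibration. Suppose that - (c0) $\mathrm{W}$ has the two out of three property; - (c1) $\mathrm{inj}(I)\subset \mathrm{W}$; - (nc0) $\mathrm{W}$ has the weak invertibility property: if $r,s,t$ are maps such that the compositions $sr$ and $ts$ are defined and belong to $\mathrm{W}$, then $s$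 belongs to $\mathrm{W}$; - (nc1) $\mathrm{cell}(J)\subset \mathrm{cof}(I)\cap \mathrm{W}$; - (nc2) every map between naively fibrant objects that is both a naive fibration and in $\mathrm{W}$ belongs to $\mathrm{inj}(I)$. Then $\mathcal{E}$ has a (closed) model category structure with class of weak equivalences $\mathrm{W}$, class of cofibrations $\mathrm{cof}(I)$ and class of fibrations $\mathrm{inj}(\mathrm{cof}(I)\cap \mathrm{W})$. Moreover, an object of $\mathcal{E}$ is fibrant in this model structure if and only if it is naively fibrant, and a map between fibrant objects is a fibration if and only if it is a naive fibration. -/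

import Mathlib

namespace NaiveFibrations

open CategoryTheory Limits MorphismProperty

universe w v u

variable {E : Type u} [Category.{v} E]

/-- `inj(K)`: the maps with the right lifting property with respect to the maps in `K`. -/
def inj (K : MorphismProperty E) : MorphismProperty E := K.rlp

/-- `cof(K)`: the maps with the left lifting property with respect to the maps in `inj(K)`. -/
def cof (K : MorphismProperty E) : MorphismProperty E := (inj K).llp

/-- `cell(K)`: the relative `K`-cell complexes, i.e. the transfinite compositions (of any
`w`-small length) of pushouts of (`w`-small) coproducts of maps in `K`. -/
def cell (K : MorphismProperty E) : MorphismProperty E :=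
  transfiniteCompositions.{w} (coproducts.{w} K).pushouts

/-- The weak invertibility property: if `r`, `s`, `t` are composable (first `r`, then `s`,
then `t`) and the two composites of `r, s` and of `s, t` are in `W`, then `s` is in `W`. -/
def WeakInvertibility (W : MorphismProperty E) : Prop :=
  ∀ ⦃X₀ X₁ X₂ X₃ : E⦄ (r : X₀ ⟶ X₁) (s : X₁ ⟶ X₂) (t : X₂ ⟶ X₃),
    W (r ≫ s) → W (s ≫ t) → W s

/-- A class of maps, viewed as a property of objects of the category of maps `Mor(E)`. -/
def arrowProperty (W : MorphismProperty E) : ObjectProperty (Arrow E) := fun f ↦ W f.hom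

/-- `W` is a full accessible subcategory of `Mor(E)`: the full subcategory of `Mor(E)` on the
maps in `W` is an accessible category and its inclusion into `Mor(E)` is an accessible
functor (it preserves `κ`-filtered colimits for some regular cardinal `κ`). -/
structure IsFullAccessibleSubcategory (W : MorphismProperty E) : Prop where
  accessible : IsAccessibleCategory.{w} (arrowProperty W).FullSubcategory
  accessible_inclusion : Functor.IsAccessible.{w} (arrowProperty W).ι

/-- `X` is naively fibrant (with respect to `J`) if `X ⟶ 1` is in `inj(J)`. Since `inj(J)` is
stable under isomorphisms, the choice of the terminal object is irrelevant. -/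
def IsNaivelyFibrant (J : MorphismProperty E) (X : E) : Prop :=
  ∃ (T : E) (hT : IsTerminal T), inj J (hT.from X)

end NaiveFibrations

/-! The small object argument gives the weak factorization system `(cof I, inj I)`; the other one
comes from Smith's method. Accessibility of `W` supplies a solution set, from which
`exists_isSmall_le_cof_inf` builds a small set inside `cof I ⊓ W` such that maps of `W` with the
right lifting property against it lie in `inj I`. A retract argument shows that this set generates
`cof I ⊓ W`, provided that class is saturated (`llp_rlp_cof_inf_le`).

Saturation holds because a map of `cof I` is in `W` exactly when it has the left lifting property
against naive fibrations between naively fibrant objects. Both directions replace the target by a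
naively fibrant object and factor the composite as a `J`-cell complex followed by a naive fibration;
two out of three and (nc2) give one direction, weak invertibility the other. The first direction
also says that these naive fibrations are fibrations, which identifies the fibrant objects. -/

open CategoryTheory Limits

universe w v u u'

/-! ### Raising the index of accessibility. -/

namespace Cardinal

/-- If `κ₁ ≤ κ`, any set of cardinality at most `2 ^ κ` has at most `2 ^ κ` subsets of
cardinality `< κ₁`. -/
lemma hasCardinalLT_setCardinalLT {κ₁ κ : Cardinal.{w}} (h : κ₁ ≤ κ) (hκ : ℵ₀ ≤ κ) {X : Type w}
    (hX : HasCardinalLT X (Order.succ (2 ^ κ))) :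
    HasCardinalLT (Subtype fun (S : Set X) ↦ HasCardinalLT S κ₁) (Order.succ (2 ^ κ)) := by
  rw [hasCardinalLT_iff_cardinal_mk_lt, Order.lt_succ_iff] at hX ⊢
  have h₁ : mk (Subtype fun (S : Set X) ↦ HasCardinalLT S κ₁) ≤ mk { t : Set X // mk t ≤ κ } :=
    Cardinal.mk_subtype_mono (fun S hS ↦ by
      rw [hasCardinalLT_iff_cardinal_mk_lt] at hS
      exact hS.le.trans h)
  refine h₁.trans ((mk_bounded_set_le X κ).trans ?_)
  calc max (mk X) ℵ₀ ^ κ ≤ (2 ^ κ) ^ κ :=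
        Cardinal.power_le_power_right (max_le hX (hκ.trans (Cardinal.cantor κ).le))
    _ = 2 ^ κ := by rw [← Cardinal.power_mul, Cardinal.mul_eq_self hκ]

end Cardinal

namespace CategoryTheory.Limits.ColimitPresentation

variable {C : Type u} [Category.{v} C] {α : Type w} [PartialOrder α] {X : C}
  (p : ColimitPresentation α X) (P : Set α → Prop)

/-- The restriction of a diagram indexed by a poset to a subset. -/
abbrev restr (B : Set α) : B ⥤ C := (Subtype.mono_coe (· ∈ B)).functor ⋙ p.diag

/-- The cocone over the restriction to a subset given by the colimit of the restriction to a
bigger subset. -/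
noncomputable def restrCocone {B B' : Set α} (h : B ≤ B') [HasColimit (p.restr B')] :
    Cocone (p.restr B) where
  pt := Limits.colimit (p.restr B')
  ι := { app b := colimit.ι (p.restr B') ⟨b.1, h b.2⟩
         naturality b b' g := (colimit.w (p.restr B')
            (homOfLE (show (⟨b.1, h b.2⟩ : B') ≤ ⟨b'.1, h b'.2⟩ from leOfHom g))).trans
            (Category.comp_id _).symm }

variable [∀ B : Subtype P, HasColimit (p.restr B.1)]

/-- The functor sending a subset of the index poset to the colimit of the restricted diagram. -/
noncomputable def colimitRestr : Subtype P ⥤ C where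
  obj B := Limits.colimit (p.restr B.1)
  map {B B'} f := colimit.desc (p.restr B.1) (p.restrCocone (leOfHom f))
  map_id B := colimit.hom_ext (fun b ↦
    (colimit.ι_desc _ _).trans (Category.comp_id _).symm)
  map_comp {B B' B''} f g := colimit.hom_ext (fun b ↦ by
    refine (colimit.ι_desc _ _).trans ((colimit.ι_desc (p.restrCocone (leOfHom g))
      ⟨b.1, leOfHom f b.2⟩).symm.trans ?_)
    exact (colimit.ι_desc_assoc (p.restrCocone (leOfHom f)) b _).symm)

/-- The inclusion of a term of the diagram in the colimit of its restriction to a subset. -/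
noncomputable def ιRestr (B : Subtype P) (a : α) (ha : a ∈ B.1) :
    p.diag.obj a ⟶ (p.colimitRestr P).obj B :=
  colimit.ι (p.restr B.1) ⟨a, ha⟩

lemma ιRestr_map {B B' : Subtype P} (f : B ⟶ B') (a : α) (ha : a ∈ B.1) :
    p.ιRestr P B a ha ≫ (p.colimitRestr P).map f = p.ιRestr P B' a (leOfHom f ha) :=
  colimit.ι_desc _ _

lemma map_ιRestr (B : Subtype P) {a b : α} (f : a ⟶ b) (ha : a ∈ B.1) (hb : b ∈ B.1) :
    p.diag.map f ≫ p.ιRestr P B b hb = p.ιRestr P B a ha :=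
  colimit.w (p.restr B.1) (homOfLE (show (⟨a, ha⟩ : B.1) ≤ ⟨b, hb⟩ from leOfHom f))

variable {p P} in
lemma colimitRestr_hom_ext {B : Subtype P} {Y : C} {f g : (p.colimitRestr P).obj B ⟶ Y}
    (h : ∀ (a : α) (ha : a ∈ B.1), p.ιRestr P B a ha ≫ f = p.ιRestr P B a ha ≫ g) : f = g :=
  colimit.hom_ext (fun b ↦ h b.1 b.2)

/-- The canonical map from the colimit of the restriction of the diagram. -/
noncomputable def colimitRestrDesc (B : Subtype P) : (p.colimitRestr P).obj B ⟶ X :=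
  colimit.desc (p.restr B.1) (p.cocone.whisker _)

lemma ιRestr_desc (B : Subtype P) (a : α) (ha : a ∈ B.1) :
    p.ιRestr P B a ha ≫ p.colimitRestrDesc P B = p.ι.app a :=
  colimit.ι_desc _ _

/-- The colimit of a diagram indexed by a poset is the colimit of the colimits of the
restrictions to the subsets in a directed family covering the poset. -/
noncomputable def colimitRestrPresentation
    (hP : ∀ B B' : Subtype P, ∃ B'' : Subtype P, B ≤ B'' ∧ B' ≤ B'')
    (hP' : ∀ a : α, ∃ B : Subtype P, a ∈ B.1) :
    ColimitPresentation (Subtype P) X where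
  diag := p.colimitRestr P
  ι := { app B := p.colimitRestrDesc P B
         naturality B B' f := colimitRestr_hom_ext (fun a ha ↦ by
          dsimp
          rw [Category.comp_id, ← Category.assoc, ιRestr_map, ιRestr_desc, ιRestr_desc]) }
  isColimit :=
    -- By directedness, the leg at `a` does not depend on the chosen subset containing `a`.
    have indep (s : Cocone (p.colimitRestr P)) (a : α) (B B' : Subtype P) (h : a ∈ B.1)
        (h' : a ∈ B'.1) : p.ιRestr P B a h ≫ s.ι.app B = p.ιRestr P B' a h' ≫ s.ι.app B' := by
      obtain ⟨B'', hB, hB'⟩ := hP B B'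
      rw [← s.w (homOfLE hB), ← s.w (homOfLE hB'),
        ← Category.assoc, ← Category.assoc, ιRestr_map, ιRestr_map]
    let t (s : Cocone (p.colimitRestr P)) : Cocone p.diag :=
      { pt := s.pt
        ι := { app a := p.ιRestr P (hP' a).choose a (hP' a).choose_spec ≫ s.ι.app _
               naturality a b f := by
                obtain ⟨B, hB, hB'⟩ := hP (hP' a).choose (hP' b).choose
                have ha := hB (hP' a).choose_spec
                have hb := hB' (hP' b).choose_spec
                rw [indep s a _ B _ ha, indep s b _ B _ hb]
                exact (Category.assoc _ _ _).symm.trans ((congr_arg (· ≫ s.ι.app B)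
                  (map_ιRestr p P B f ha hb)).trans (Category.comp_id _).symm) } }
    { desc s := p.isColimit.desc (t s)
      fac s B := colimitRestr_hom_ext (fun a ha ↦ by
        refine Eq.trans ?_ ((p.isColimit.fac (t s) a).trans (indep s a _ _ _ ha))
        rw [← Category.assoc]
        exact congr_arg (· ≫ p.isColimit.desc (t s)) (p.ιRestr_desc P B a ha))
      uniq s m hm := p.isColimit.hom_ext (fun a ↦ by
        refine Eq.trans ?_ (p.isColimit.fac (t s) a).symm
        have := hm (hP' a).choose
        dsimp at this
        dsimp [t]
        rw [← this, ← Category.assoc, ιRestr_desc]) }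

end CategoryTheory.Limits.ColimitPresentation

namespace CategoryTheory

open Cardinal

variable {C : Type u} [Category.{v} C]

lemma HasCardinalFilteredColimits.of_le {κ κ' : Cardinal.{w}} [Fact κ.IsRegular]
    [Fact κ'.IsRegular] [HasCardinalFilteredColimits C κ] (h : κ ≤ κ') :
    HasCardinalFilteredColimits C κ' where
  hasColimitsOfShape J _ _ :=
    have := IsCardinalFiltered.of_le J h
    HasCardinalFilteredColimits.hasColimitsOfShape C κ J

/-- If `κ₁` satisfies the cofinality condition characterizing that it is sharply smaller than
`κ₂`, then any `κ₁`-accessible category is `κ₂`-accessible. -/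
lemma IsCardinalAccessibleCategory.of_exists_cofinal {κ₁ κ₂ : Cardinal.{w}} [Fact κ₁.IsRegular]
    [Fact κ₂.IsRegular] [IsCardinalAccessibleCategory C κ₁] (h₀ : κ₁ < κ₂)
    (h : ∀ (X : Type w) (_ : HasCardinalLT X κ₂),
      ∃ (Y : Set (CardinalDirectedPoset.SetCardinalLT κ₁ X)), HasCardinalLT Y κ₂ ∧ IsCofinal Y) :
    IsCardinalAccessibleCategory C κ₂ := by
  obtain ⟨P, _, hP⟩ := HasCardinalFilteredGenerator.exists_generator C κ₁
  have := HasCardinalFilteredColimits.of_le (C := C) h₀.le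
  suffices (P.colimitsCardinalClosure κ₂).IsCardinalFilteredGenerator κ₂ from
    { toHasCardinalFilteredGenerator := this.hasCardinalFilteredGenerator }
  refine ⟨P.colimitsCardinalClosure_le_isCardinalPresentable
    (hP.le_isCardinalPresentable.trans (isCardinalPresentable_monotone _ h₀.le)), fun X ↦ ?_⟩
  obtain ⟨J, _, _, ⟨p₀⟩⟩ := hP.exists_colimitsOfShape X
  obtain ⟨α, _, _, G, _⟩ := IsCardinalFiltered.exists_cardinal_directed J κ₁
  let p := p₀.reindex G
  -- Being `κ₁`-directed ensures that the colimit over `B` exists; having fewer than `κ₂` elements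
  -- makes it `κ₂`-presentable.
  let Q (B : Set α) : Prop := IsCardinalFiltered B κ₁ ∧ HasCardinalLT B κ₂
  have hQ (A : Set α) (hA : HasCardinalLT A κ₂) : ∃ B : Subtype Q, A ⊆ B.1 := by
    obtain ⟨B, h₁, h₂, h₃⟩ :=
      SharplyLT.exists_isCardinalFiltered_set_of_exists_cofinal h₀ h A hA
    exact ⟨⟨B, h₂, h₃⟩, h₁⟩
  have hκ₂ : ℵ₀ ≤ κ₂ := Cardinal.IsRegular.aleph0_le Fact.out
  have (B : Subtype Q) : HasColimit (p.restr B.1) := by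
    have := B.2.1
    have := HasCardinalFilteredColimits.hasColimitsOfShape C κ₁ B.1
    infer_instance
  -- By regularity, a union of fewer than `κ₂` members still has size `< κ₂`; `hQ` then encloses it
  -- in a `κ₁`-directed member.
  have : IsCardinalFiltered (Subtype Q) κ₂ := isCardinalFiltered_preorder _ _ (fun K f hK ↦ by
    rw [← hasCardinalLT_iff_cardinal_mk_lt] at hK
    obtain ⟨B, hB⟩ := hQ (⋃ k, (f k).1) (hasCardinalLT_iUnion _ hK (fun k ↦ (f k).2.2))
    exact ⟨B, fun k ↦ (Set.subset_iUnion (fun k ↦ (f k).1) k).trans hB⟩)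
  refine ⟨Subtype Q, inferInstance, inferInstance, ⟨
    { toColimitPresentation := p.colimitRestrPresentation Q (fun B B' ↦ ?_) (fun a ↦ ?_)
      prop_diag_obj B := ?_ }⟩⟩
  · obtain ⟨B'', hB⟩ := hQ (B.1 ∪ B'.1) (hasCardinalLT_union hκ₂ B.2.2 B'.2.2)
    exact ⟨B'', Set.subset_union_left.trans hB, Set.subset_union_right.trans hB⟩
  · obtain ⟨B, hB⟩ := hQ {a} (hasCardinalLT_of_finite _ _ hκ₂)
    exact ⟨B, hB rfl⟩
  · have hB : HasCardinalLT (Arrow B.1) κ₂ :=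
      (hasCardinalLT_prod hκ₂ B.2.2 B.2.2).of_injective (fun f ↦ (f.left, f.right))
        (fun f g hfg ↦ by
          obtain ⟨a, b, f⟩ := f
          obtain ⟨a', b', g⟩ := g
          obtain ⟨rfl, rfl⟩ := Prod.ext_iff.1 hfg
          obtain rfl := Subsingleton.elim f g
          rfl)
    have := P.isClosedUnderColimitsOfShape_colimitsCardinalClosure κ₂ B.1 hB
    exact ObjectProperty.prop_colimit _ _
      (fun b ↦ P.le_colimitsCardinalClosure κ₂ _ (p.prop_diag_obj b.1))

/-- Any accessible category is `κ'`-accessible for arbitrarily large regular cardinals `κ'`. -/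
lemma IsAccessibleCategory.exists_isCardinalAccessibleCategory [IsAccessibleCategory.{w} C]
    (κ : Cardinal.{w}) :
    ∃ (κ' : Cardinal.{w}) (_ : Fact κ'.IsRegular), κ ≤ κ' ∧ IsCardinalAccessibleCategory C κ' := by
  obtain ⟨κ₁, hκ₁, _⟩ := IsAccessibleCategory.exists_cardinal.{w} C
  -- With `κ' = (2 ^ μ)⁺`, a set of size `< κ'` has fewer than `κ'` subsets of size `< κ₁`, so all
  -- of them together serve as the cofinal family.
  let μ := max κ κ₁
  have hμ : ℵ₀ ≤ μ := hκ₁.out.aleph0_le.trans (le_max_right _ _)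
  have hμ' : μ < Order.succ ((2 : Cardinal.{w}) ^ μ) := (Cardinal.cantor μ).trans (Order.lt_succ _)
  have : Fact (Order.succ ((2 : Cardinal.{w}) ^ μ)).IsRegular :=
    ⟨Cardinal.isRegular_succ (hμ.trans (Cardinal.cantor μ).le)⟩
  refine ⟨Order.succ ((2 : Cardinal.{w}) ^ μ), inferInstance, (le_max_left _ _).trans hμ'.le, ?_⟩
  refine IsCardinalAccessibleCategory.of_exists_cofinal (κ₁ := κ₁)
    ((le_max_right _ _).trans_lt hμ') (fun X hX ↦ ⟨Set.univ, ?_, .univ⟩)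
  rw [hasCardinalLT_iff_of_equiv (Equiv.Set.univ _)]
  exact hasCardinalLT_setCardinalLT (le_max_right _ _) hμ hX

end CategoryTheory

/-! ### Limits and the small object argument in locally presentable categories. -/

namespace CategoryTheory

variable {C : Type u} [Category.{v} C]

/-- A cocomplete category which contains a dense small subcategory is complete. -/
lemma Functor.IsDense.hasLimitsOfSize {J : Type w} [SmallCategory J] {D : Type u}
    [Category.{w} D] [HasColimitsOfSize.{w, w} D] (F : J ⥤ D) [F.IsDense] :
    HasLimitsOfSize.{w, w} D := by
  -- Density makes the restricted Yoneda functor fully faithful and cocompleteness gives it a left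
  -- adjoint, so `D` is reflective in presheaves.
  have : (Presheaf.restrictedULiftYoneda.{w} F).IsRightAdjoint :=
    (Presheaf.uliftYonedaAdjunction.{w} _ (uliftYoneda.{w}.leftKanExtensionUnit F)).isRightAdjoint
  let : Reflective (Presheaf.restrictedULiftYoneda.{w} F) :=
    ⟨_, Adjunction.ofIsRightAdjoint (Presheaf.restrictedULiftYoneda.{w} F)⟩
  exact hasLimits_of_reflective (Presheaf.restrictedULiftYoneda.{w} F)

lemma IsLocallyPresentable.hasColimitsOfSize [IsLocallyPresentable.{w} C] :
    HasColimitsOfSize.{w, w} C := by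
  obtain ⟨κ, _, _⟩ := IsLocallyPresentable.exists_cardinal.{w} C
  infer_instance

lemma IsLocallyPresentable.locallySmall [IsLocallyPresentable.{w} C] : LocallySmall.{w} C := by
  obtain ⟨κ, _, _⟩ := IsLocallyPresentable.exists_cardinal.{w} C
  infer_instance

lemma IsLocallyPresentable.hasLimitsOfSize [IsLocallyPresentable.{w} C] :
    HasLimitsOfSize.{w, w} C := by
  have := IsLocallyPresentable.locallySmall.{w} (C := C)
  let e := ShrinkHoms.equivalence.{w} C
  have := e.isLocallyPresentable
  obtain ⟨κ, _, _⟩ := IsLocallyPresentable.exists_cardinal.{w} (ShrinkHoms C)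
  let P := isCardinalPresentable (ShrinkHoms C) κ
  have := Functor.IsDense.hasLimitsOfSize ((equivSmallModel.{w} P.FullSubcategory).inverse ⋙ P.ι)
  exact ⟨fun J _ ↦ Adjunction.hasLimitsOfShape_of_equivalence e.functor⟩

/-- The objects of a small family of presentable objects are `κ`-presentable for a common `κ`. -/
lemma exists_forall_isCardinalPresentable {ι : Type u'} [Small.{w} ι] (X : ι → C)
    [∀ i, IsPresentable.{w} (X i)] :
    ∃ (κ : Cardinal.{w}) (_ : Fact κ.IsRegular), ∀ i, IsCardinalPresentable (X i) κ := by
  have h (i : ι) : ∃ (κ : Cardinal.{w}) (_ : Fact κ.IsRegular),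
      IsCardinalPresentable (X i) κ := Functor.IsAccessible.exists_cardinal
  choose κ₀ _ hκ₀ using h
  obtain ⟨κ, hκ, h⟩ := HasCardinalLT.exists_regular_cardinal_forall.{w}
    (fun i ↦ (κ₀ i).ord.ToType)
  have : Fact κ.IsRegular := ⟨hκ⟩
  exact ⟨κ, inferInstance, fun i ↦ isCardinalPresentable_of_le (X i) (κ := κ₀ i) (by
    simpa [hasCardinalLT_iff_cardinal_mk_lt] using (h i).le)⟩

/-- The sources of the maps in `I` are `κ`-presentable for a common `κ`, so iterations of length
`κ.ord` are long enough. -/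
lemma MorphismProperty.hasSmallObjectArgument [IsLocallyPresentable.{w} C]
    (I : MorphismProperty C) [MorphismProperty.IsSmall.{w} I] : HasSmallObjectArgument.{w} I := by
  have := IsLocallyPresentable.locallySmall.{w} (C := C)
  have := IsLocallyPresentable.hasColimitsOfSize.{w} (C := C)
  obtain ⟨κ, hκ, h⟩ := exists_forall_isCardinalPresentable.{w} (fun i : I.toSet ↦ i.1.left)
  have : Nonempty κ.ord.ToType := by simpa using hκ.out.ne_zero
  let := WellFoundedLT.toOrderBot κ.ord.ToType
  exact ⟨κ, inferInstance, inferInstance,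
    { hasPushouts := have := hasFiniteColimits_of_hasColimitsOfSize.{w, w} C
                     inferInstance
      hasCoproducts := fun J ↦ inferInstance
      hasIterationOfShape := { }
      preservesColimit {A B X Y} i hi f hf := by
        have : IsCardinalPresentable A κ := h ⟨CategoryTheory.Arrow.mk i, hi⟩
        have := preservesColimitsOfShape_of_isCardinalPresentable A κ κ.ord.ToType
        infer_instance }⟩

/-- The factorization given by the small object argument, with a relative cell complex
as the first map. -/
lemma MorphismProperty.exists_transfiniteCompositions_rlp_fac (I : MorphismProperty C)
    [HasSmallObjectArgument.{w} I] {X Y : C} (f : X ⟶ Y) :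
    ∃ (Z : C) (i : X ⟶ Z) (p : Z ⟶ Y),
      transfiniteCompositions.{w} (coproducts.{w} I).pushouts i ∧ I.rlp p ∧ i ≫ p = f := by
  have : Fact I.smallObjectκ.IsRegular := smallObjectκ_isRegular I
  exact ⟨_, SmallObject.ιObj I I.smallObjectκ f, SmallObject.πObj I I.smallObjectκ f,
    transfiniteCompositionsOfShape_le_transfiniteCompositions _ _ _
      (SmallObject.transfiniteCompositionsOfShape_ιObj I I.smallObjectκ f),
    SmallObject.rlp_πObj I I.smallObjectκ f, SmallObject.ιObj_πObj I I.smallObjectκ f⟩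

end CategoryTheory

/-! ### The solution set condition and a small generating set. -/

namespace CategoryTheory

variable {C : Type u} [Category.{v} C]

/-- A map in the category of arrows whose source has `κ`-presentable source and target
factors through a stage of any `κ`-filtered colimit. -/
lemma Arrow.exists_hom_of_isColimit (κ : Cardinal.{w}) [Fact κ.IsRegular] {J : Type w}
    [SmallCategory J] [IsCardinalFiltered J κ] [HasColimitsOfShape J C] {F : J ⥤ Arrow C}
    {c : Cocone F} (hc : IsColimit c) {f : Arrow C} [IsCardinalPresentable f.left κ]
    [IsCardinalPresentable f.right κ] (φ : f ⟶ c.pt) :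
    ∃ (j : J) (ψ : f ⟶ F.obj j), ψ ≫ c.ι.app j = φ := by
  have := isFiltered_of_isCardinalFiltered J κ
  have hl := isColimitOfPreserves Arrow.leftFunc hc
  have hr := isColimitOfPreserves Arrow.rightFunc hc
  obtain ⟨j₁, a, ha⟩ : ∃ (j : J) (a : f.left ⟶ (F.obj j).left), a ≫ (c.ι.app j).left = φ.left :=
    IsCardinalPresentable.exists_hom_of_isColimit κ hl φ.left
  obtain ⟨j₂, b, hb⟩ : ∃ (j : J) (b : f.right ⟶ (F.obj j).right),
      b ≫ (c.ι.app j).right = φ.right :=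
    IsCardinalPresentable.exists_hom_of_isColimit κ hr φ.right
  -- The two components need not form a square at a finite stage, but they do in the colimit, hence
  -- at some later stage `k`.
  have h : (a ≫ (F.obj j₁).hom) ≫ (c.ι.app j₁).right =
      (f.hom ≫ b) ≫ (c.ι.app j₂).right := by
    rw [Category.assoc, Category.assoc, hb, ← Arrow.w φ, ← ha, Category.assoc]
    exact congr_arg (a ≫ ·) (Arrow.w (c.ι.app j₁)).symm
  obtain ⟨k, u, v, huv⟩ : ∃ (k : J) (u : j₁ ⟶ k) (v : j₂ ⟶ k),
      (a ≫ (F.obj j₁).hom) ≫ (F.map u).right = (f.hom ≫ b) ≫ (F.map v).right :=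
    IsCardinalPresentable.exists_eq_of_isColimit κ hr _ _ h
  rw [Category.assoc, Category.assoc] at huv
  refine ⟨k, Arrow.homMk (a ≫ (F.map u).left) (b ≫ (F.map v).right) ?_, ?_⟩
  · rw [Category.assoc, Arrow.w, huv]
  · have hu := congr_arg Arrow.Hom.left (c.w u)
    have hv := congr_arg Arrow.Hom.right (c.w v)
    dsimp at hu hv
    ext
    · exact (Category.assoc _ _ _).trans ((congr_arg (a ≫ ·) hu).trans ha)
    · exact (Category.assoc _ _ _).trans ((congr_arg (b ≫ ·) hv).trans hb)

end CategoryTheory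

namespace NaiveFibrations

open MorphismProperty

variable {E : Type u} [Category.{v} E] [IsLocallyPresentable.{w} E]

/-- The solution set condition for a full accessible subcategory of the category of maps. -/
lemma IsFullAccessibleSubcategory.exists_solution_set {W : MorphismProperty E}
    (hW : IsFullAccessibleSubcategory.{w} W) (I : MorphismProperty E)
    [MorphismProperty.IsSmall.{w} I] :
    ∃ (S : MorphismProperty E), MorphismProperty.IsSmall.{w} S ∧ S ≤ W ∧
      ∀ (i w : Arrow E) (φ : i ⟶ w), I i.hom → W w.hom →
        ∃ (s : Arrow E) (a : i ⟶ s) (b : s ⟶ w), S s.hom ∧ a ≫ b = φ := by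
  have := IsLocallyPresentable.hasColimitsOfSize.{w} (C := E)
  have := hW.accessible
  have := hW.accessible_inclusion
  let x (i : I.toSet ⊕ I.toSet) : E := Sum.elim (fun i ↦ i.1.left) (fun i ↦ i.1.right) i
  obtain ⟨κ₁, _, h₁⟩ := exists_forall_isCardinalPresentable.{w} x
  obtain ⟨κ₂, _, _⟩ := Functor.IsAccessible.exists_cardinal.{w} (F := (arrowProperty W).ι)
  obtain ⟨κ, _, hκ, _⟩ := IsAccessibleCategory.exists_isCardinalAccessibleCategory
    (C := (arrowProperty W).FullSubcategory) (max κ₁ κ₂)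
  have := (arrowProperty W).ι.isCardinalAccessible_of_le ((le_max_right _ _).trans hκ)
  obtain ⟨P, _, hP⟩ := HasCardinalFilteredGenerator.exists_small_generator
    (arrowProperty W).FullSubcategory κ
  refine ⟨.ofHoms (fun y : Subtype P ↦ y.1.obj.hom), inferInstance, ?_, ?_⟩
  · rintro _ _ _ ⟨y⟩
    exact y.1.property
  · intro i w φ hi hw
    obtain ⟨J, _, _, ⟨p⟩⟩ := hP.exists_colimitsOfShape ⟨w, hw⟩
    have := (arrowProperty W).ι.preservesColimitsOfShape_of_isCardinalAccessible κ J
    have : IsCardinalPresentable i.left κ₁ := h₁ (.inl ⟨i, hi⟩)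
    have : IsCardinalPresentable i.right κ₁ := h₁ (.inr ⟨i, hi⟩)
    have := isCardinalPresentable_of_le i.left ((le_max_left _ _).trans hκ)
    have := isCardinalPresentable_of_le i.right ((le_max_left _ _).trans hκ)
    obtain ⟨j, ψ, hψ⟩ := Arrow.exists_hom_of_isColimit κ
      (isColimitOfPreserves (arrowProperty W).ι p.isColimit) φ
    exact ⟨_, ψ, _, ⟨(⟨_, p.prop_diag_obj j⟩ : Subtype P)⟩, hψ⟩

omit [IsLocallyPresentable.{w} E] in
lemma cof_self_le (I : MorphismProperty E) : I ≤ cof I := le_llp_rlp I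

/-- A map from a map in `I` to a map in `W` factors through a map which is both
in `cof(I)` and in `W`. -/
lemma exists_fac_cof_inf {W I : MorphismProperty E} [W.HasTwoOutOfThreeProperty]
    [HasSmallObjectArgument.{w} I] (hI : inj I ≤ W) {i w : Arrow E} (φ : i ⟶ w)
    (hi : I i.hom) (hw : W w.hom) :
    ∃ (j : Arrow E) (a : i ⟶ j) (b : j ⟶ w), (cof I ⊓ W) j.hom ∧ a ≫ b = φ := by
  have := IsLocallyPresentable.hasColimitsOfSize.{w} (C := E)
  have := hasFiniteColimits_of_hasColimitsOfSize.{w, w} E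
  -- Factor the corner map `q` as `c` in `cof I`, then `p` in `inj I`: the pushout of `i` followed
  -- by `c` is in `cof I`, and in `W` by two out of three.
  let q : pushout i.hom φ.left ⟶ w.right := pushout.desc φ.right w.hom (Arrow.w φ).symm
  obtain ⟨Z, c, p, hc, hp, hcp⟩ : ∃ (Z : E) (c : pushout i.hom φ.left ⟶ Z) (p : Z ⟶ w.right),
      cof I c ∧ inj I p ∧ c ≫ p = q := by
    have h := factorizationData I.rlp.llp I.rlp q
    exact ⟨_, _, _, h.hi, h.hp, h.fac⟩
  have hr : pushout.inr i.hom φ.left ≫ q = w.hom := pushout.inr_desc _ _ _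
  have hl : pushout.inl i.hom φ.left ≫ q = φ.right := pushout.inl_desc _ _ _
  have fac : (pushout.inr i.hom φ.left ≫ c) ≫ p = w.hom := by rw [Category.assoc, hcp, hr]
  have : (cof I).IsStableUnderCobaseChange := inferInstanceAs (llp _).IsStableUnderCobaseChange
  have : (cof I).IsStableUnderComposition := inferInstanceAs (llp _).IsStableUnderComposition
  refine ⟨Arrow.mk (pushout.inr i.hom φ.left ≫ c),
    Arrow.homMk φ.left (pushout.inl i.hom φ.left ≫ c) ?_, Arrow.homMk (𝟙 _) p ?_, ⟨?_, ?_⟩, ?_⟩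
  · simp [pushout.condition_assoc]
  · simpa using fac.symm
  · exact (cof I).comp_mem _ _ ((cof I).pushout_inr _ _ (cof_self_le I _ hi)) hc
  · exact W.of_postcomp _ p (hI _ hp) (fac ▸ hw :)
  · ext <;> simp [hcp, hl]

/-- Assuming the solution set condition, the maps in `cof(I)` and in `W` admit a small set `J`
such that any map in `W` with the right lifting property with respect to `J` is in `inj(I)`. -/
lemma exists_isSmall_le_cof_inf {W I : MorphismProperty E} [W.HasTwoOutOfThreeProperty]
    (hW : IsFullAccessibleSubcategory.{w} W) [MorphismProperty.IsSmall.{w} I] (hI : inj I ≤ W) :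
    ∃ (J : MorphismProperty E), MorphismProperty.IsSmall.{w} J ∧ J ≤ cof I ⊓ W ∧
      inj J ⊓ W ≤ inj I := by
  have := IsLocallyPresentable.locallySmall.{w} (C := E)
  have := hasSmallObjectArgument.{w} I
  obtain ⟨S, _, hS, h⟩ := hW.exists_solution_set I
  have : Small.{w} S.toSet := ‹S.IsSmall›.small_toSet
  -- All squares from `I` to the solution set; local smallness keeps this family small.
  let ι := Σ (x : I.toSet × S.toSet), (x.1.1 ⟶ x.2.1)
  have H (x : ι) := exists_fac_cof_inf hI x.2 x.1.1.2 (hS _ x.1.2.2)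
  choose j a b hj fac using H
  have : LocallySmall.{w} (Arrow E) := inferInstanceAs (LocallySmall.{w} (Comma (𝟭 E) (𝟭 E)))
  have : Small.{w} ι := inferInstance
  refine ⟨.ofHoms (fun x ↦ (j x).hom), isSmall_ofHoms.{w} _, ?_, ?_⟩
  · rintro _ _ _ ⟨x⟩
    exact hj x
  · rintro X Y p ⟨hp, hp'⟩ A B i hi
    refine ⟨fun {t t'} sq ↦ ?_⟩
    obtain ⟨s, α, β, hs, hαβ⟩ := h (Arrow.mk i) (Arrow.mk p) (Arrow.homMk t t' sq.w) hi hp'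
    let x : ι := ⟨⟨⟨Arrow.mk i, hi⟩, ⟨s, hs⟩⟩, α⟩
    obtain ⟨j', a', b', _, hab⟩ : ∃ (j' : CategoryTheory.Arrow E)
        (a' : CategoryTheory.Arrow.mk i ⟶ j') (b' : j' ⟶ CategoryTheory.Arrow.mk p),
        HasLiftingProperty j'.hom p ∧ a' ≫ b' = CategoryTheory.Arrow.homMk t t' sq.w :=
      ⟨j x, a x, b x ≫ β, hp _ ⟨x⟩, by rw [← Category.assoc, fac x, hαβ]⟩
    have sq' : CommSq b'.left j'.hom p b'.right := ⟨CategoryTheory.Arrow.w b'⟩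
    have hl : a'.left ≫ b'.left = t := congr_arg CategoryTheory.Arrow.Hom.left hab
    have hr : a'.right ≫ b'.right = t' := congr_arg CategoryTheory.Arrow.Hom.right hab
    have ha : a'.left ≫ j'.hom = i ≫ a'.right := CategoryTheory.Arrow.w a'
    exact ⟨⟨{ l := a'.right ≫ sq'.lift
              fac_left := by rw [← reassoc_of% ha, sq'.fac_left, hl]
              fac_right := by rw [Category.assoc, sq'.fac_right, hr] }⟩⟩

end NaiveFibrations

/-! ### Naive fibrations and saturation of `cof I ⊓ W`. -/

namespace NaiveFibrations

open MorphismProperty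

variable {E : Type u} [Category.{v} E]

lemma cell_le_cof (J : MorphismProperty E) : cell.{w} J ≤ cof J :=
  transfiniteCompositions_pushouts_coproducts_le_llp_rlp J

lemma self_le_cell (J : MorphismProperty E) : J ≤ cell.{w} J :=
  J.le_coproducts.trans ((le_pushouts _).trans (le_transfiniteCompositions _))

lemma exists_cell_inj_fac (J : MorphismProperty E) [HasSmallObjectArgument.{w} J]
    {X Y : E} (f : X ⟶ Y) :
    ∃ (Z : E) (i : X ⟶ Z) (p : Z ⟶ Y), cell.{w} J i ∧ inj J p ∧ i ≫ p = f :=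
  J.exists_transfiniteCompositions_rlp_fac f

lemma IsNaivelyFibrant.inj_from {J : MorphismProperty E} {X : E} (hX : IsNaivelyFibrant J X)
    {T : E} (hT : IsTerminal T) : inj J (hT.from X) := by
  obtain ⟨T', hT', h⟩ := hX
  refine ((rlp J).arrow_mk_iso_iff (Arrow.isoMk (Iso.refl X) (hT'.uniqueUpToIso hT)
    (hT.hom_ext _ _))).1 h

lemma IsNaivelyFibrant.of_isTerminal (J : MorphismProperty E) {T : E} (hT : IsTerminal T) :
    IsNaivelyFibrant J T :=
  ⟨T, hT, by
    rw [hT.hom_ext (hT.from T) (𝟙 T)]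
    exact (rlp J).id_mem T⟩

lemma IsNaivelyFibrant.of_inj {J : MorphismProperty E} {X Y : E} (hY : IsNaivelyFibrant J Y)
    {f : X ⟶ Y} (hf : inj J f) : IsNaivelyFibrant J X := by
  obtain ⟨T, hT, h⟩ := hY
  refine ⟨T, hT, ?_⟩
  rw [hT.hom_ext (hT.from X) (f ≫ hT.from Y)]
  exact (rlp J).comp_mem _ _ hf h

lemma IsNaivelyFibrant.exists_extension {J : MorphismProperty E} {X : E}
    (hX : IsNaivelyFibrant J X) {A B : E} {j : A ⟶ B} (hj : cof J j) (a : A ⟶ X) :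
    ∃ b : B ⟶ X, j ≫ b = a := by
  obtain ⟨T, hT, h⟩ := hX
  have := hj _ h
  have sq : CommSq a j (hT.from X) (hT.from B) := ⟨hT.hom_ext _ _⟩
  exact ⟨sq.lift, sq.fac_left⟩

lemma exists_naivelyFibrant_replacement (J : MorphismProperty E) [HasSmallObjectArgument.{w} J]
    [HasTerminal E] (X : E) :
    ∃ (X' : E) (i : X ⟶ X'), cell.{w} J i ∧ IsNaivelyFibrant J X' := by
  obtain ⟨X', i, p, hi, hp, -⟩ := exists_cell_inj_fac.{w} J (terminal.from X)
  exact ⟨X', i, hi, (IsNaivelyFibrant.of_isTerminal J terminalIsTerminal).of_inj hp⟩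

/-- The naive fibrations between naively fibrant objects. -/
def naiveFibrationsBetweenFibrant (J : MorphismProperty E) : MorphismProperty E :=
  fun X Y f ↦ IsNaivelyFibrant J X ∧ IsNaivelyFibrant J Y ∧ inj J f

variable {W I J : MorphismProperty E} [W.HasTwoOutOfThreeProperty]
  [HasSmallObjectArgument.{w} J] [HasTerminal E]

/-- The maps both in `cof(I)` and in `W` have the left lifting property with respect to
the naive fibrations between naively fibrant objects. -/
lemma cof_inf_le_llp_naiveFibrationsBetweenFibrant (nc1 : cell.{w} J ≤ cof I ⊓ W)
    (nc2 : ∀ ⦃X Y : E⦄ (f : X ⟶ Y), IsNaivelyFibrant J X → IsNaivelyFibrant J Y →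
      inj J f → W f → inj I f) :
    cof I ⊓ W ≤ (naiveFibrationsBetweenFibrant J).llp := by
  rintro A B i ⟨hi, hiW⟩ X Y p ⟨hX, hY, hp⟩
  refine ⟨fun {f g} sq ↦ ?_⟩
  obtain ⟨B', k, hk, hB'⟩ := exists_naivelyFibrant_replacement.{w} J B
  obtain ⟨A', j, q, hj, hq, fac⟩ := exists_cell_inj_fac.{w} J (i ≫ k)
  have hqW : W q := W.of_precomp j q (nc1 _ hj).2 (by
    rw [fac]
    exact W.comp_mem _ _ hiW (nc1 _ hk).2)
  have hqI : inj I q := nc2 q (hB'.of_inj hq) hB' hq hqW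
  obtain ⟨g', hg'⟩ := hY.exists_extension (cell_le_cof _ _ hk) g
  have := cell_le_cof _ _ hj _ hp
  have sq₁ : CommSq f j p (q ≫ g') := ⟨by rw [reassoc_of% fac, hg', sq.w]⟩
  -- The lift in `sq₂` goes from `B` to `A'`, the one in `sq₁` from `A'` to `X`.
  have := hi _ hqI
  have sq₂ : CommSq j i q k := ⟨fac⟩
  exact ⟨⟨{ l := sq₂.lift ≫ sq₁.lift }⟩⟩

/-- The maps in `W` contain the maps which have the left lifting property with respect to
the naive fibrations between naively fibrant objects. -/
lemma llp_naiveFibrationsBetweenFibrant_le (nc0 : WeakInvertibility W)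
    (nc1 : cell.{w} J ≤ cof I ⊓ W) :
    (naiveFibrationsBetweenFibrant J).llp ≤ W := by
  intro A B i hi
  obtain ⟨B', k, hk, hB'⟩ := exists_naivelyFibrant_replacement.{w} J B
  obtain ⟨A', j, q, hj, hq, fac⟩ := exists_cell_inj_fac.{w} J (i ≫ k)
  have := hi q ⟨hB'.of_inj hq, hB', hq⟩
  have sq : CommSq j i q k := ⟨fac⟩
  -- Weak invertibility applies to `i`, `sq.lift`, `q`, whose consecutive composites are the cell
  -- complexes `j` and `k`.
  have hjW : W (i ≫ sq.lift) := by
    rw [sq.fac_left]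
    exact (nc1 _ hj).2
  have hl : W sq.lift := nc0 i sq.lift q hjW (by
    rw [sq.fac_right]
    exact (nc1 _ hk).2)
  exact W.of_postcomp _ _ hl hjW

/-- Both `inj I` and the naive fibrations between naively fibrant objects lie in the right lifting
class; taking `llp` reverses these inclusions. -/
lemma llp_rlp_cof_inf_le (nc0 : WeakInvertibility W) (nc1 : cell.{w} J ≤ cof I ⊓ W)
    (nc2 : ∀ ⦃X Y : E⦄ (f : X ⟶ Y), IsNaivelyFibrant J X → IsNaivelyFibrant J Y →
      inj J f → W f → inj I f) :
    (cof I ⊓ W).rlp.llp ≤ cof I ⊓ W := by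
  refine le_inf ?_ ?_
  · refine antitone_llp ?_
    rw [← le_llp_iff_le_rlp]
    exact inf_le_left
  · refine le_trans (antitone_llp ?_) (llp_naiveFibrationsBetweenFibrant_le.{w} nc0 nc1)
    rw [← le_llp_iff_le_rlp]
    exact cof_inf_le_llp_naiveFibrationsBetweenFibrant.{w} nc1 nc2

end NaiveFibrations

/-! ### Smith's theorem and the model structure. -/

namespace NaiveFibrations

open MorphismProperty HomotopicalAlgebra

variable {E : Type u} [Category.{v} E]

/-- Smith's recognition theorem, in terms of weak factorization systems. -/
lemma isWeakFactorizationSystem_cof_inf [IsLocallyPresentable.{w} E] {W I : MorphismProperty E}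
    [W.HasTwoOutOfThreeProperty] (hW : IsFullAccessibleSubcategory.{w} W)
    [MorphismProperty.IsSmall.{w} I] (hI : inj I ≤ W)
    (h : (cof I ⊓ W).rlp.llp ≤ cof I ⊓ W) :
    IsWeakFactorizationSystem (cof I ⊓ W) (inj (cof I ⊓ W)) ∧
      inj (cof I ⊓ W) ⊓ W = inj I := by
  -- This `J` is the generating set built from the solution set, not the one defining naive
  -- fibrations.
  obtain ⟨J, _, hJ, hJ'⟩ := exists_isSmall_le_cof_inf hW hI
  have := hasSmallObjectArgument.{w} J
  have hJ₁ : J.rlp.llp ≤ cof I ⊓ W := le_trans (antitone_llp (antitone_rlp hJ)) h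
  have hJ₂ : cof I ⊓ W = J.rlp.llp := by
    refine le_antisymm ?_ hJ₁
    rintro A B i ⟨hi, hiW⟩
    -- Retract argument: the second factor is in `W`, hence in `inj I`, so `i` lifts against it.
    have d := factorizationData J.rlp.llp J.rlp i
    have hp : W d.p := W.of_precomp d.i d.p (hJ₁ _ d.hi).2 (by rwa [d.fac])
    have := hi _ (hJ' _ ⟨d.hp, hp⟩)
    exact J.rlp.llp.of_retract (RetractArrow.ofLeftLiftingProperty d.fac) d.hi
  have hJ₃ : inj (cof I ⊓ W) = J.rlp := by
    rw [hJ₂]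
    exact J.rlp_llp_rlp
  refine ⟨?_, le_antisymm ?_ (le_inf ?_ hI)⟩
  · rw [hJ₃, hJ₂]
    exact ⟨J.rlp_llp_rlp, rfl, inferInstance⟩
  · rw [hJ₃]
    exact hJ'
  · refine (le_llp_iff_le_rlp _ _).1 inf_le_left

end NaiveFibrations

open CategoryTheory HomotopicalAlgebra NaiveFibrations

theorem proposition1p3 {E : Type u} [Category.{v} E] [IsLocallyPresentable.{w} E]
    (W I J : MorphismProperty E)
    (hW : IsFullAccessibleSubcategory.{w} W)
    (hI : MorphismProperty.IsSmall.{w} I) (hJ : MorphismProperty.IsSmall.{w} J)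
    (c0 : W.HasTwoOutOfThreeProperty)
    (c1 : inj I ≤ W)
    (nc0 : WeakInvertibility W)
    (nc1 : cell.{w} J ≤ cof I ⊓ W)
    (nc2 : ∀ ⦃X Y : E⦄ (f : X ⟶ Y), IsNaivelyFibrant J X → IsNaivelyFibrant J Y →
      inj J f → W f → inj I f) :
    ∃ _ : ModelCategory E,
      weakEquivalences E = W ∧
      cofibrations E = cof I ∧
      fibrations E = inj (cof I ⊓ W) ∧
      (∀ X : E, IsFibrant X ↔ IsNaivelyFibrant J X) ∧
      (∀ ⦃X Y : E⦄ (f : X ⟶ Y), IsFibrant X → IsFibrant Y → (Fibration f ↔ inj J f)) := by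
  have := IsLocallyPresentable.hasLimitsOfSize.{w} (C := E)
  have := IsLocallyPresentable.hasColimitsOfSize.{w} (C := E)
  have := hasFiniteLimits_of_hasLimitsOfSize.{w, w} E
  have := hasFiniteColimits_of_hasColimitsOfSize.{w, w} E
  have := MorphismProperty.hasSmallObjectArgument.{w} I
  have := MorphismProperty.hasSmallObjectArgument.{w} J
  obtain ⟨h₁, h₂⟩ := isWeakFactorizationSystem_cof_inf hW c1
    (llp_rlp_cof_inf_le.{w} nc0 nc1 nc2)
  let : CategoryWithWeakEquivalences E := ⟨W⟩
  let : CategoryWithCofibrations E := ⟨cof I⟩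
  let : CategoryWithFibrations E := ⟨inj (cof I ⊓ W)⟩
  have : (weakEquivalences E).HasTwoOutOfThreeProperty := c0
  have : MorphismProperty.IsWeakFactorizationSystem (trivialCofibrations E) (fibrations E) := h₁
  have : MorphismProperty.IsWeakFactorizationSystem (cofibrations E) (trivialFibrations E) := by
    have h : trivialFibrations E = inj I := h₂
    rw [h]
    exact ⟨I.rlp_llp_rlp, rfl, inferInstanceAs (I.rlp.llp.HasFactorization I.rlp)⟩
  have inj_of_fibration {X Y : E} {f : X ⟶ Y} (hf : inj (cof I ⊓ W) f) : inj J f :=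
    MorphismProperty.antitone_rlp ((self_le_cell.{w} J).trans nc1) _ hf
  have fibration_of_inj {X Y : E} {f : X ⟶ Y} (hX : IsNaivelyFibrant J X)
      (hY : IsNaivelyFibrant J Y) (hf : inj J f) : inj (cof I ⊓ W) f :=
    fun _ _ i hi ↦ cof_inf_le_llp_naiveFibrationsBetweenFibrant.{w} nc1 nc2 i hi f ⟨hX, hY, hf⟩
  have isFibrant_iff (X : E) : IsFibrant X ↔ IsNaivelyFibrant J X := by
    have hT := IsNaivelyFibrant.of_isTerminal J (terminalIsTerminal (C := E))
    rw [HomotopicalAlgebra.isFibrant_iff, fibration_iff]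
    exact ⟨fun h ↦ hT.of_inj (inj_of_fibration h), fun h ↦ fibration_of_inj h hT
      (h.inj_from terminalIsTerminal)⟩
  refine ⟨ModelCategory.mk' E, rfl, rfl, rfl, isFibrant_iff, fun X Y f hX hY ↦ ?_⟩
  rw [fibration_iff]
  exact ⟨inj_of_fibration, fibration_of_inj ((isFibrant_iff X).1 hX) ((isFibrant_iff Y).1 hY)⟩
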